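/- **Adaptive BH.** For $p$-values $p_1,\dots,p_m$ with order statistics $p_{(1)}\le\dots\le p_{(m)}$, $p_{(0)}:=0$, a level $\alpha$, a capping $\kappa\in(0,1]$ and an estimator $\hat\pi_0\in[0,\infty)$, the procedure $\mathrm{ABH}_\alpha(\hat\pi_0,\kappa)$ rejects the hypotheses $i$ with $p_i\le\hat t$, where $\hat t=\kappa\wedge(\alpha\hat k/(m\hat\pi_0))$ and $\hat k=\max\{k\in\{0,\dots,m\}: p_{(k)}\le \kappa\wedge(\alpha k/(m\hat\pi_0))\}$ (with $1/0=+\infty$; the bound is $0$ for $k=0$). Write $\mathrm{ABH}_\alpha(\hat\pi_0)=\mathrm{ABH}_\alpha(\hat\pi_0,1)$. With $H_i\in\{0,1\}$ indicating whether the $i$-th null is false ($H_i=1$), the FDR and the power are $\mathbb E_\theta\big[\sum_i 1\{H_i=0,p_i\le\hat t\}/(\hat k\vee1)\big]$ and $\mathbb E_\theta\big[\sum_i 1\{H_i=1,p_i\le\hat t\}/m\big]$. **Models.** A parameter is $\theta=(\pi_0,F_0,F_1)$ with $\pi_0\in[0,1]$ and $F_0,F_1$ continuous distribution functions on $[0,1]$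 with $F_0(x)\le x$ on $[0,1]$; put $F=\pi_0F_0+(1-\pi_0)F_1$. Consider one of the following two settings. * Independent two-group setting, $t=m$: the $H_i$ are iid Bernoulli$(1-\pi_0)$ and, given $(H_i)_i$, the $p_i$ are independent with $p_i\sim F_{H_i}$. * Conformal two-group setting, $t=(n,m)$, where $F_0=I$ is the uniform distribution function for every parameter: $q_1,\dots,q_n$ are iid uniform on $(0,1)$, independently $(H_i,q_{n+i})_{i\le m}$ follows the independent two-group setting with parameter $(\pi_0,I,F_1)$, $S_j=1-q_j$ for $j\le n+m$, and $p_i=(n+1)^{-1}\big(1+\sum_{j=1}^n 1\{S_j\ge S_{n+i}\}\big)$ for $i\le m$. Here $t\to\infty$ means $m\to\infty$, resp. $n\wedge m\to\infty$. A $\pi_0$-estimator is, for each $t$, a measurable $[0,\infty)$-valued function of the $p$-values. Let $\Theta$ be any set of parameters (with $F_0=I$ for all its elements in the conformal setting). Assume that for every $\theta\in\Theta$ the maximum $$\pi_0^*(\theta)=\max\{\pi_0^*\in(0,1]:\ \exists F_0^*,F_1^*,\ (\pi_0^*,F_0^*,F_1^*)\in\Theta,\ \pi_0^*F_0^*+(1-\pi_0^*)F_1^*=F\}$$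 exists. A rate is a family $r_t(\theta)\ge0$ with $r_t(\theta)\to0$ as $t\to\infty$, for each $\theta\in\Theta$. * $\tilde\pi_0$ is FDR-conservative over $\Theta$ after $\kappa$-capping if $\mathrm{FDR}_\theta(\mathrm{ABH}_\alpha(\tilde\pi_0,\kappa))\le\alpha$ for all $\alpha\in(0,1)$, all $\theta\in\Theta$ and all $m\ge2$ (and $n\ge1$ in the conformal setting); for $\kappa=1$ it is called FDR-conservative over $\Theta$. * $\tilde\pi_0$ is concentrating over $\Theta$ with rates $\eta,\delta$ if there is $\bar\pi_0(\theta)>0$, not depending on $t$, such that for every $\theta\in\Theta$ and all $t$ large enough $\mathbb P_\theta(|\tilde\pi_0-\bar\pi_0(\theta)|\le\eta_t(\theta))\ge1-\delta_t(\theta)$. **Theorem.** Let $\hat\pi_0$ be a $\pi_0$-estimator and $\eta^*,\delta^*$ rates such that for every $\theta\in\Theta$ and all $t$ large enough $\mathbb P_\theta(\hat\pi_0\le\pi_0^*(\theta)+\eta^*_t(\theta))\ge1-\delta^*_t(\theta)$. Put $$\alpha'=\alpha\Big(1-\frac{\eta_t^*(\theta)}{\pi_0^*(\theta)}\Big)\Big(1-\frac{\eta_t(\theta)}{\pi_0^*(\theta)-\eta_t(\theta)}\Big),\qquad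 \alpha''=\alpha\Big(1-\frac{\eta_t^*(\theta)}{\pi_0^*(\theta)}\Big).$$ (i) (No capping.) For every $\pi_0$-estimator $\tilde\pi_0$ that is FDR-conservative over $\Theta$ and concentrating over $\Theta$ with rates $\eta,\delta$, for all $\theta\in\Theta$ and all $t$ large enough (depending on $\theta$), $$\sup_{\alpha\in(0,1]}\{\mathrm{Pow}_\theta(\mathrm{ABH}_{\alpha'}(\tilde\pi_0))-\mathrm{Pow}_\theta(\mathrm{ABH}_\alpha(\hat\pi_0))\}\le\delta^*_t(\theta)+\delta_t(\theta).$$ Moreover, for the oracle choice, for all $\theta\in\Theta$ and all $t$ large enough, $\sup_{\alpha\in(0,1]}\{\mathrm{Pow}_\theta(\mathrm{ABH}_{\alpha''}(\pi_0^*(\theta)))-\mathrm{Pow}_\theta(\mathrm{ABH}_\alpha(\hat\pi_0))\}\le\delta^*_t(\theta)$. (ii) (Capping $\kappa\in(0,1)$.) Let $\kappa'\in(0,1]$ and suppose that $\kappa'=1$ or that $F_0=I$ for all $(\pi_0,F_0,F_1)\in\Theta$. For every $\pi_0$-estimator $\tilde\pi_0$ that is FDR-conservative over $\Theta$ after $\kappa'$-capping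 and concentrating over $\Theta$ with rates $\eta,\delta$, for all $\theta\in\Theta$ and all $t$ large enough, $$\sup_{0<\alpha\le\kappa\pi_0^*(\theta)}\{\mathrm{Pow}_\theta(\mathrm{ABH}_{\alpha'}(\tilde\pi_0))-\mathrm{Pow}_\theta(\mathrm{ABH}_\alpha(\hat\pi_0,\kappa))\}\le\delta^*_t(\theta)+\delta_t(\theta).$$ Moreover, for the oracle choice (without any condition on $F_0$), for all $\theta\in\Theta$ and all $t$ large enough, $\sup_{0<\alpha\le\kappa\pi_0^*(\theta)}\{\mathrm{Pow}_\theta(\mathrm{ABH}_{\alpha''}(\pi_0^*(\theta)))-\mathrm{Pow}_\theta(\mathrm{ABH}_\alpha(\hat\pi_0,\kappa))\}\le\delta^*_t(\theta)$. -/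

import Mathlib

open MeasureTheory ProbabilityTheory Filter Set

noncomputable section

namespace TwoGroup

/-! ### Adaptive Benjamini-Hochberg procedure -/

/-- The order statistic `p_(k)`, `1 ≤ k ≤ m` (the `k`-th smallest value), with `p_(0) = 0`. -/
def orderStat {m : ℕ} (p : Fin m → ℝ) (k : ℕ) : ℝ :=
  if h : 0 < k ∧ k ≤ m then p (Tuple.sort p ⟨k - 1, by omega⟩) else 0

/-- The critical value `κ ∧ (α k / (m π))`, with the convention `1/0 = +∞` (so that it equals `κ`
when `π = 0` and `k ≥ 1`); it is `0` for `k = 0`. -/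
def critValue (m : ℕ) (α κ π : ℝ) (k : ℕ) : ℝ :=
  if π = 0 ∧ k ≠ 0 then κ else min κ (α * k / (m * π))

open Classical in
/-- `k̂ = max {k ∈ {0, …, m} : p_(k) ≤ κ ∧ (α k / (m π))}`; the index `k = 0` always qualifies. -/
def numRej {m : ℕ} (α κ π : ℝ) (p : Fin m → ℝ) : ℕ :=
  Nat.findGreatest (fun k => orderStat p k ≤ critValue m α κ π k) m

/-- The threshold `t̂ = κ ∧ (α k̂ / (m π))`: the hypotheses with `p_i ≤ t̂` are rejected. -/
def threshold {m : ℕ} (α κ π : ℝ) (p : Fin m → ℝ) : ℝ :=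
  critValue m α κ π (numRej α κ π p)

/-! ### Two-group models -/

/-- A parameter `θ = (π₀, F₀, F₁)`. The distributions of the `p`-values under the null and under
the alternative are probability measures on `[0,1]` with continuous distribution functions, and
the null is super-uniform. -/
structure Param where
  pi0 : ℝ
  null : ProbabilityMeasure ℝ
  alt : ProbabilityMeasure ℝ
  pi0_mem : pi0 ∈ Icc (0 : ℝ) 1
  null_supp : (null : Measure ℝ) (Icc 0 1) = 1
  alt_supp : (alt : Measure ℝ) (Icc 0 1) = 1
  null_cont : Continuous fun x => cdf (null : Measure ℝ) x
  alt_cont : Continuous fun x => cdf (alt : Measure ℝ) x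
  null_superunif : ∀ x ∈ Icc (0 : ℝ) 1, cdf (null : Measure ℝ) x ≤ x

/-- The null distribution function is that of the uniform distribution on `(0,1)`. -/
def Param.HasUniformNull (θ : Param) : Prop :=
  ∀ x ∈ Icc (0 : ℝ) 1, cdf (θ.null : Measure ℝ) x = x

/-- The mixture distribution function `F = π₀ F₀ + (1 - π₀) F₁`. -/
def Param.mixCDF (θ : Param) (x : ℝ) : ℝ :=
  θ.pi0 * cdf (θ.null : Measure ℝ) x + (1 - θ.pi0) * cdf (θ.alt : Measure ℝ) x

/-- The law of one pair `(H, p)`: `H` is Bernoulli with success probability `1 - π₀` (`true` means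
`H = 1`, a false null), and given `H`, `p ∼ F₀` if `H = 0` and `p ∼ F₁` if `H = 1`. -/
def Param.pairLaw (θ : Param) : Measure (Bool × ℝ) :=
  ENNReal.ofReal θ.pi0 • (Measure.dirac false).prod (θ.null : Measure ℝ) +
    ENNReal.ofReal (1 - θ.pi0) • (Measure.dirac true).prod (θ.alt : Measure ℝ)

/-- The law of `(H_i, p_i)`, `i = 1, …, m`, in the independent two-group model. -/
def indepLaw (m : ℕ) (θ : Param) : Measure (Fin m → Bool × ℝ) :=
  Measure.pi fun _ => θ.pairLaw

/-- The conformal `p`-value of a test score `S` given calibration scores `Sc_1, …, Sc_n`: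
`(n + 1)⁻¹ (1 + #{j : Sc_j ≥ S})`. -/
def conformalP {n : ℕ} (Sc : Fin n → ℝ) (S : ℝ) : ℝ :=
  (1 + ∑ j, if S ≤ Sc j then (1 : ℝ) else 0) / (n + 1)

/-- The law of `(H_i, p_i)`, `i = 1, …, m`, in the conformal two-group model: `q_1, …, q_n` are iid
uniform on `(0,1)`, `(H_i, q_{n+i})` follows independently the independent two-group model, the
scores are `1 - q`, and the `p_i` are the conformal `p`-values of the test scores. -/
def conformalLaw (n m : ℕ) (θ : Param) : Measure (Fin m → Bool × ℝ) :=
  ((Measure.pi fun _ : Fin n => (volume : Measure ℝ).restrict (Icc 0 1)).prod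
    (indepLaw m θ)).map
    fun ω i => ((ω.2 i).1, conformalP (fun j => 1 - ω.1 j) (1 - (ω.2 i).2))

/-- The two settings. -/
inductive Setting
  | independent
  | conformal

namespace Setting

/-- The asymptotic index `t`: `t = m` in the independent setting, `t = (n, m)` in the conformal
one. With the product order, `atTop` on pairs means `min n m → ∞`. -/
def Index : Setting → Type
  | independent => ℕ
  | conformal => ℕ × ℕ

instance instPreorderIndex : (s : Setting) → Preorder s.Index
  | independent => inferInstanceAs (Preorder ℕ)
  | conformal => inferInstanceAs (Preorder (ℕ × ℕ))

/-- The number `m` of tested hypotheses. -/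
def size : (s : Setting) → s.Index → ℕ
  | independent, m => m
  | conformal, nm => nm.2

/-- Sample sizes for which FDR control is asked: `m ≥ 2`, and a nonempty calibration sample. -/
def Admissible : (s : Setting) → s.Index → Prop
  | independent, m => (2 : ℕ) ≤ m
  | conformal, nm => 1 ≤ nm.1 ∧ 2 ≤ nm.2

/-- The joint law of the `(H_i, p_i)` under `P_θ`. -/
def law : (s : Setting) → (t : s.Index) → Param → Measure (Fin (s.size t) → Bool × ℝ)
  | independent, m, θ => indepLaw m θ
  | conformal, nm, θ => conformalLaw nm.1 nm.2 θ

/-- Parameter spaces: arbitrary sets of parameters, with the constraint that in the conformal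
setting (which is parametrized by `(π₀, F₁)`) the null distribution is uniform. -/
def IsParamSpace : Setting → Set Param → Prop
  | independent, _ => True
  | conformal, Θ => ∀ θ ∈ Θ, θ.HasUniformNull

/-- A `π₀`-estimator: for each `t`, a measurable function of the `p`-values valued in `[0, ∞)`. -/
structure Estimator (s : Setting) where
  est : (t : s.Index) → (Fin (s.size t) → ℝ) → ℝ
  measurable_est : ∀ t, Measurable (est t)
  nonneg_est : ∀ t p, 0 ≤ est t p

variable (s : Setting)

/-- The FDR under `P_θ` of `ABH_α(π̂, κ)`, where `π̂ = e p`. -/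
def fdr (t : s.Index) (θ : Param) (e : (Fin (s.size t) → ℝ) → ℝ) (α κ : ℝ) : ℝ :=
  ∫ x, (∑ i, if (x i).1 = false ∧
        (x i).2 ≤ threshold α κ (e fun j => (x j).2) (fun j => (x j).2) then (1 : ℝ) else 0) /
      max (numRej α κ (e fun j => (x j).2) (fun j => (x j).2) : ℝ) 1 ∂(s.law t θ)

/-- The power under `P_θ` of `ABH_α(π̂, κ)`, where `π̂ = e p`. -/
def power (t : s.Index) (θ : Param) (e : (Fin (s.size t) → ℝ) → ℝ) (α κ : ℝ) : ℝ :=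
  ∫ x, (∑ i, if (x i).1 = true ∧
        (x i).2 ≤ threshold α κ (e fun j => (x j).2) (fun j => (x j).2) then (1 : ℝ) else 0) /
      (s.size t : ℝ) ∂(s.law t θ)

/-- A rate: nonnegative, and for each fixed `θ ∈ Θ` converging to zero as `t` tends to infinity. -/
def IsRate (Θ : Set Param) (r : s.Index → Param → ℝ) : Prop :=
  ∀ θ ∈ Θ, (∀ t, 0 ≤ r t θ) ∧ Tendsto (fun t => r t θ) atTop (nhds 0)

/-- FDR-conservative over `Θ` after `κ`-capping. -/
def FDRConservative (Θ : Set Param) (e : s.Estimator) (κ : ℝ) : Prop :=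
  ∀ α ∈ Ioo (0 : ℝ) 1, ∀ t, s.Admissible t → ∀ θ ∈ Θ, s.fdr t θ (e.est t) α κ ≤ α

/-- Concentrating over `Θ` around `π̄₀(θ) > 0` (not depending on `t`) with rates `η`, `δ`. How large
`t` has to be may depend on `θ`. -/
def Concentrating (Θ : Set Param) (e : s.Estimator) (piBar : Param → ℝ)
    (η δ : s.Index → Param → ℝ) : Prop :=
  s.IsRate Θ η ∧ s.IsRate Θ δ ∧ ∀ θ ∈ Θ, 0 < piBar θ ∧
    ∀ᶠ t in atTop,
      1 - δ t θ ≤ (s.law t θ).real {x | |e.est t (fun i => (x i).2) - piBar θ| ≤ η t θ}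

end Setting

/-- The null proportions in `(0,1]` of the parameters of `Θ` indistinguishable from `θ`. -/
def nullProportions (Θ : Set Param) (θ : Param) : Set ℝ :=
  {x | x ∈ Ioc (0 : ℝ) 1 ∧ ∃ θ' ∈ Θ, θ'.pi0 = x ∧ ∀ y, θ.mixCDF y = θ'.mixCDF y}

/-- `π₀*(θ)`, the largest element of `nullProportions Θ θ` (whenever there is one). -/
def piStar (Θ : Set Param) (θ : Param) : ℝ := sSup (nullProportions Θ θ)

/-- The estimator is below `π₀*(θ) + η*_t(θ)` with probability at least `1 - δ*_t(θ)`, for `t` large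
enough, with rates `η*` and `δ*`. -/
def Setting.ConcentratesBelow (s : Setting) (Θ : Set Param) (e : s.Estimator)
    (ηs δs : s.Index → Param → ℝ) : Prop :=
  s.IsRate Θ ηs ∧ s.IsRate Θ δs ∧ ∀ θ ∈ Θ, ∀ᶠ t in atTop,
    1 - δs t θ ≤ (s.law t θ).real {x | e.est t (fun i => (x i).2) ≤ piStar Θ θ + ηs t θ}

end TwoGroup

end

namespace TwoGroup

/-! ### Deterministic properties of the procedure -/

/-! The BH threshold increases with the ratio of level to estimated null proportion, so the theorem
reduces to comparing two ratios on an event of high probability. If `π̂ ≤ π* + η*` and `π̃ ≥ π* -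
η`, the two correction factors in `α'` are just enough to give `α' / π̃ ≤ α / (π* + η*) ≤ α / π̂`
when `π̂ > 0` (when `π̂ = 0` the critical values equal the cap). Hence `ABH_{α'}(π̃)` rejects no
more than `ABH_α(π̂)` (`threshold_le_of_ratio_le`, `level_ratio_le`). Off that event the powers
differ by at most one, which produces the error `δ* + δ` (`power_sub_le`). With a cap `κ`, the
condition `α ≤ κ π*` makes `α / (π* + η*) ≤ κ`, so the cap costs nothing in the comparison.

What remains is `π̃ ≥ π* - η` with high probability, that is, `π̄ ≥ π*`: an FDR-conservative
estimator cannot concentrate below `π*` (`pi0_le_of_fdr_le`, `piStar_le_piBar`). Take `θ'` in `Θ`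
with the same mixture `F` and null proportion `π*`. The `p`-values have the same law under `θ` and
`θ'`, so `π̃` concentrates at `b = π̄(θ)` under `θ'` too. If `b < π*`, choose `α` strictly between
`b κ / F(κ)` and `π* κ / F(κ)`. The first inequality makes the critical value reach the cap, so that
exactly the `p`-values below `κ` are rejected (`numRej_eq_card`). By the law of large numbers the
false discovery proportion is then close to `π* F₀(κ) / F(κ) = π* κ / F(κ) > α`, against FDR control
under `θ'`. The identity `F₀(κ) = κ` is automatic for `κ = 1` and is the uniform-null assumption
otherwise.

In the conformal setting the `p`-values are dependent. Their counts are sandwiched between counts of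
the underlying independent variables at two points near `κ` (`abs_hitCount_conformalMap_sub_le`). -/

theorem orderStat_le_iff {m : ℕ} (p : Fin m → ℝ) {k : ℕ} (hk : 0 < k) (hkm : k ≤ m) (c : ℝ) :
    orderStat p k ≤ c ↔ k ≤ (Finset.univ.filter fun i => p i ≤ c).card := by
  have h := Tuple.lt_card_le_iff_apply_le_of_monotone (j := ⟨k - 1, by omega⟩) (a := c)
    (Tuple.monotone_sort p)
  have hc : (Finset.univ.filter fun i => (p ∘ Tuple.sort p) i ≤ c).card =
      (Finset.univ.filter fun i => p i ≤ c).card :=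
    Finset.card_equiv (Tuple.sort p) (by simp)
  rw [hc] at h
  simp only [Function.comp_apply] at h
  rw [orderStat, dif_pos ⟨hk, hkm⟩, ← h]
  omega

theorem critValue_zero (m : ℕ) {α κ π : ℝ} (hκ : 0 ≤ κ) : critValue m α κ π 0 = 0 := by
  simp [critValue, hκ]

theorem critValue_le_cap (m : ℕ) (α κ π : ℝ) (k : ℕ) : critValue m α κ π k ≤ κ := by
  unfold critValue
  split_ifs
  · exact le_rfl
  · exact min_le_left _ _

theorem critValue_mono (m : ℕ) {α κ π : ℝ} (hα : 0 ≤ α) (hκ : 0 ≤ κ) (hπ : 0 ≤ π) :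
    Monotone (critValue m α κ π) := by
  intro a b hab
  by_cases h0 : a = 0
  · subst h0
    rw [critValue_zero m hκ]
    unfold critValue
    split_ifs
    · exact hκ
    · exact le_min hκ (by positivity)
  · have hb : b ≠ 0 := by omega
    unfold critValue
    by_cases hπ0 : π = 0
    · simp [hπ0, h0, hb]
    · simp only [hπ0, false_and, if_false]
      gcongr

theorem orderStat_numRej_le {m : ℕ} {α κ : ℝ} (hκ : 0 ≤ κ) (π : ℝ) (p : Fin m → ℝ) :
    orderStat p (numRej α κ π p) ≤ critValue m α κ π (numRej α κ π p) := by
  classical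
  unfold numRej
  refine Nat.findGreatest_spec (P := fun k => orderStat p k ≤ critValue m α κ π k)
    (Nat.zero_le m) ?_
  simp [critValue_zero m hκ, orderStat]

theorem numRej_le_size {m : ℕ} (α κ π : ℝ) (p : Fin m → ℝ) : numRej α κ π p ≤ m :=
  Nat.findGreatest_le m

theorem le_numRej {m : ℕ} {α κ π : ℝ} {p : Fin m → ℝ} {k : ℕ} (hk : k ≤ m)
    (h : orderStat p k ≤ critValue m α κ π k) : k ≤ numRej α κ π p :=
  Nat.le_findGreatest hk h

/-- Here `c` is the high-probability upper bound for the estimate `π`, so one ratio condition at `c`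
serves every such `π`, including `π = 0`. The level `α'` may be negative. The alternative `α / c ≤
κ` says that the cap `κ` lies above the bound `α k / (m c)` for every `k ≤ m`. -/
theorem critValue_le_critValue {m : ℕ} {α α' κ κ' π π' : ℝ} (hκ : 0 ≤ κ) (hκ' : 0 ≤ κ')
    (hα : 0 ≤ α) (hπ : 0 ≤ π) (hπ' : 0 < π') {c : ℝ} (hc : π ≤ c)
    (hr : α' / π' ≤ α / c) (hcap : κ' ≤ κ ∨ α / c ≤ κ) (k : ℕ) (hkm : k ≤ m) :
    critValue m α' κ' π' k ≤ critValue m α κ π k := by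
  rcases Nat.eq_zero_or_pos k with rfl | hk
  · simp [critValue_zero, hκ, hκ']
  have hm : (0 : ℝ) < m := by exact_mod_cast hk.trans_le hkm
  have hkR : (0 : ℝ) < k := by exact_mod_cast hk
  have hkm' : (k : ℝ) / m ≤ 1 := by
    rw [div_le_one hm]; exact_mod_cast hkm
  have e : ∀ a b : ℝ, a * k / (m * b) = a / b * (k / m) := fun a b => by
    rw [mul_comm (m : ℝ) b, mul_div_mul_comm]
  have h1 : α' * k / (m * π') ≤ α / c * (k / m) := by
    rw [e]; gcongr
  have hcap' : min κ' (α' * k / (m * π')) ≤ κ := by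
    rcases hcap with h | h
    · exact (min_le_left _ _).trans h
    · refine (min_le_right _ _).trans (h1.trans (le_trans ?_ h))
      exact mul_le_of_le_one_right (div_nonneg hα (hπ.trans hc)) hkm'
  unfold critValue
  rw [if_neg (by simp [hπ'.ne'])]
  -- For `π = 0` the right side is the cap itself; otherwise both members of the minimum have to be
  -- dominated.
  split_ifs with h0
  · exact hcap'
  · refine le_min hcap' ((min_le_right _ _).trans (h1.trans ?_))
    rw [e]
    have hπ0 : 0 < π := lt_of_le_of_ne hπ (fun h => h0 ⟨h.symm, hk.ne'⟩)
    gcongr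

/-- Larger critical values keep the old `k̂` feasible, so `k̂` can only grow; monotonicity in `k`
then finishes. -/
theorem threshold_le_of_ratio_le {m : ℕ} {α α' κ κ' π π' : ℝ} (p : Fin m → ℝ) (hκ : 0 ≤ κ)
    (hκ' : 0 ≤ κ') (hα : 0 ≤ α) (hπ : 0 ≤ π) (hπ' : 0 < π') {c : ℝ} (hc : π ≤ c)
    (hr : α' / π' ≤ α / c) (hcap : κ' ≤ κ ∨ α / c ≤ κ) :
    threshold α' κ' π' p ≤ threshold α κ π p := by
  have h := fun k hk => critValue_le_critValue (m := m) hκ hκ' hα hπ hπ' hc hr hcap k hk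
  have hs := numRej_le_size α' κ' π' p
  exact (h _ hs).trans (critValue_mono m hα hκ hπ
    (le_numRej hs ((orderStat_numRej_le hκ' _ _).trans (h _ hs))))

/-- If the uncapped critical value reaches the cap at the number of `p`-values below the cap, then
the procedure rejects exactly these `p`-values. -/
theorem numRej_eq_card {m : ℕ} {α κ π : ℝ} (hκ : 0 ≤ κ) (p : Fin m → ℝ)
    (hpos : 0 < (Finset.univ.filter fun i => p i ≤ κ).card)
    (h : π ≠ 0 → κ ≤ α * ((Finset.univ.filter fun i => p i ≤ κ).card : ℕ) / (m * π)) :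
    numRej α κ π p = (Finset.univ.filter fun i => p i ≤ κ).card ∧ threshold α κ π p = κ := by
  set R := (Finset.univ.filter fun i => p i ≤ κ).card with hR
  have hRm : R ≤ m := (Finset.card_le_univ _).trans (by simp)
  have hcrit : critValue m α κ π R = κ := by
    unfold critValue
    split_ifs with h0
    · rfl
    · exact min_eq_left (h (fun hπ => h0 ⟨hπ, hpos.ne'⟩))
  have hle : R ≤ numRej α κ π p := by
    refine le_numRej hRm ?_
    rw [hcrit, orderStat_le_iff p hpos hRm]
  have hge : numRej α κ π p ≤ R :=
    (orderStat_le_iff p (hpos.trans_le hle) (numRej_le_size _ _ _ _) κ).1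
      ((orderStat_numRej_le hκ _ _).trans (critValue_le_cap _ _ _ _ _))
  have heq := le_antisymm hge hle
  exact ⟨heq, by rw [threshold, heq, hcrit]⟩

/-! ### Measurability -/

theorem measurable_orderStat {m : ℕ} (k : ℕ) :
    Measurable fun p : Fin m → ℝ => orderStat p k := by
  by_cases hk : 0 < k ∧ k ≤ m
  · refine measurable_of_Iic fun c => ?_
    -- Rewriting sublevel sets as counts avoids any measurability question about the sorting
    -- permutation.
    have : (fun p : Fin m → ℝ => orderStat p k) ⁻¹' Iic c =
        {p | (k : ℝ) ≤ ∑ i, (Iic c).indicator (fun _ => (1 : ℝ)) (p i)} := by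
      ext p
      have e : ∑ i, (Iic c).indicator (fun _ => (1 : ℝ)) (p i) =
          ((Finset.univ.filter fun i => p i ≤ c).card : ℝ) := by
        simp [indicator_apply, Finset.sum_boole]
      simp only [mem_preimage, mem_Iic, mem_ofPred_eq, orderStat_le_iff p hk.1 hk.2 c, e,
        Nat.cast_le]
    rw [this]
    refine measurableSet_le measurable_const (Finset.measurable_sum _ fun i _ => ?_)
    exact (measurable_const.indicator measurableSet_Iic).comp (measurable_pi_apply i)
  · simp only [orderStat, dif_neg hk]
    exact measurable_const

theorem measurable_critValue (m : ℕ) (α κ : ℝ) (k : ℕ) :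
    Measurable fun π : ℝ => critValue m α κ π k := by
  unfold critValue
  refine Measurable.ite ?_ measurable_const ?_
  · by_cases hk : k = 0 <;> simp [hk]
  · fun_prop

theorem measurable_numRej {m : ℕ} (α κ : ℝ) {e : (Fin m → ℝ) → ℝ} (he : Measurable e) :
    Measurable fun p : Fin m → ℝ => numRej α κ (e p) p := by
  classical
  unfold numRej
  exact measurable_findGreatest fun k _ =>
    measurableSet_le (measurable_orderStat k) ((measurable_critValue m α κ k).comp he)

theorem measurable_threshold {m : ℕ} (α κ : ℝ) {e : (Fin m → ℝ) → ℝ} (he : Measurable e) :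
    Measurable fun p : Fin m → ℝ => threshold α κ (e p) p := by
  have : Measurable fun q : ℝ × ℕ => critValue m α κ q.1 q.2 :=
    measurable_from_prod_countable_left fun k => measurable_critValue m α κ k
  exact this.comp (he.prodMk (measurable_numRej α κ he))

/-! ### Weak law of large numbers for counts -/

/-- The number of coordinates of `x` lying in `A`. -/
noncomputable def hitCount {E : Type*} {m : ℕ} (A : Set E) (x : Fin m → E) : ℝ :=
  ∑ i, A.indicator (fun _ => (1 : ℝ)) (x i)

theorem hitCount_le_of_imp {E E' : Type*} {m : ℕ} {A : Set E} {A' : Set E'} {x : Fin m → E}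
    {x' : Fin m → E'} (h : ∀ i, x i ∈ A → x' i ∈ A') : hitCount A x ≤ hitCount A' x' := by
  classical
  refine Finset.sum_le_sum fun i _ => ?_
  simp only [indicator_apply]
  split_ifs with h1 h2 h2
  · exact le_rfl
  · exact absurd (h i h1) h2
  · exact zero_le_one
  · exact le_rfl

theorem hitCount_univ {E : Type*} {m : ℕ} (x : Fin m → E) : hitCount univ x = m := by
  simp [hitCount]

theorem hitCount_le {E : Type*} {m : ℕ} (A : Set E) (x : Fin m → E) : hitCount A x ≤ m :=
  (hitCount_le_of_imp fun i _ => mem_univ (x i)).trans_eq (hitCount_univ x)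

theorem measurable_hitCount {E : Type*} [MeasurableSpace E] (m : ℕ) {A : Set E}
    (hA : MeasurableSet A) : Measurable fun x : Fin m → E => hitCount A x :=
  Finset.measurable_sum _ fun i _ =>
    (measurable_const.indicator hA).comp (measurable_pi_apply i)

theorem pi_real_hitCount_deviation_le {E : Type*} [MeasurableSpace E] (μ : Measure E)
    [IsProbabilityMeasure μ] {A : Set E} (hA : MeasurableSet A) {m : ℕ} (hm : 0 < m) {ε : ℝ}
    (hε : 0 < ε) :
    (Measure.pi fun _ : Fin m => μ).real {x | ε ≤ |hitCount A x / m - μ.real A|} ≤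
      1 / (4 * ε ^ 2) / m := by
  have hm' : (0 : ℝ) < m := by exact_mod_cast hm
  set f : E → ℝ := A.indicator fun _ => (1 : ℝ) with hf
  have hfm : Measurable f := measurable_const.indicator hA
  have hfb : ∀ x, f x ∈ Icc (0 : ℝ) 1 := fun x => by
    classical
    simp only [hf, indicator_apply]; split_ifs <;> simp
  have hfL : MemLp f 2 μ := MemLp.of_bound hfm.aestronglyMeasurable 1
    (ae_of_all _ fun x => by rw [Real.norm_of_nonneg (hfb x).1]; exact (hfb x).2)
  set P := Measure.pi fun _ : Fin m => μ
  have hX : (fun x : Fin m → E => hitCount A x) = ∑ i, fun x : Fin m → E => f (x i) := by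
    ext x; simp [hitCount, hf]
  have hXi : ∀ i, MemLp (fun x : Fin m → E => f (x i)) 2 P := fun i =>
    hfL.comp_measurePreserving (measurePreserving_eval (fun _ : Fin m => μ) i)
  have hXL : MemLp (fun x : Fin m → E => hitCount A x) 2 P := by
    rw [hX]; exact memLp_finsetSum' _ fun i _ => hXi i
  have hmean : ∫ x, hitCount A x ∂P = m * μ.real A := by
    have : ∀ i : Fin m, ∫ x, f (x i) ∂P = μ.real A := fun i => by
      rw [← integral_map (μ := P) (φ := fun x : Fin m → E => x i) (f := f)
        (measurable_pi_apply i).aemeasurable hfm.aestronglyMeasurable,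
        (measurePreserving_eval (fun _ : Fin m => μ) i).map_eq]
      exact integral_indicator_one hA
    have h2 : ∫ x, hitCount A x ∂P = ∑ i, ∫ x, f (x i) ∂P :=
      integral_finsetSum _ fun i _ => (hXi i).integrable (by norm_num)
    rw [h2]; simp [this]
  have hvar : variance (fun x : Fin m → E => hitCount A x) P ≤ m * (1 / 4) := by
    rw [hX, variance_sum_pi fun _ => hfL]
    -- A variable with values in `[0,1]` has variance at most `1/4`; Chebyshev at `m ε` then gives
    -- the constant `1 / (4 ε²)`.
    have := variance_le_sq_of_bounded (μ := μ) (ae_of_all _ hfb) hfm.aemeasurable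
    calc ∑ i : Fin m, variance f μ ≤ ∑ i : Fin m, ((1 - 0) / 2 : ℝ) ^ 2 :=
          Finset.sum_le_sum fun _ _ => this
      _ = m * (1 / 4) := by simp; norm_num
  have hch := meas_ge_le_variance_div_sq hXL (c := m * ε) (by positivity)
  rw [hmean] at hch
  have hset : {x : Fin m → E | ε ≤ |hitCount A x / m - μ.real A|} =
      {x | m * ε ≤ |hitCount A x - m * μ.real A|} := by
    ext x
    have : hitCount A x - m * μ.real A = m * (hitCount A x / m - μ.real A) := by
      field_simp
    simp only [mem_ofPred_eq]
    rw [this, abs_mul, abs_of_pos hm', mul_le_mul_iff_right₀ hm']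
  rw [hset, measureReal_def]
  refine (ENNReal.toReal_mono ENNReal.ofReal_ne_top hch).trans ?_
  rw [ENNReal.toReal_ofReal (div_nonneg (variance_nonneg _ _) (by positivity))]
  calc _ ≤ m * (1 / 4) / (m * ε) ^ 2 := by gcongr
    _ = 1 / (4 * ε ^ 2) / m := by field_simp

theorem eventually_pi_real_hitCount_deviation_le {E : Type*} [MeasurableSpace E] (μ : Measure E)
    [IsProbabilityMeasure μ] {A : Set E} (hA : MeasurableSet A) {ε ρ : ℝ} (hε : 0 < ε)
    (hρ : 0 < ρ) :
    ∀ᶠ m : ℕ in atTop,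
      (Measure.pi fun _ : Fin m => μ).real {x | ε ≤ |hitCount A x / m - μ.real A|} ≤ ρ := by
  have h1 : Tendsto (fun m : ℕ => 1 / (4 * ε ^ 2) / (m : ℝ)) atTop (nhds 0) :=
    tendsto_const_div_atTop_nhds_zero_nat _
  filter_upwards [h1.eventually (ge_mem_nhds hρ), eventually_gt_atTop 0] with m h hm
  exact (pi_real_hitCount_deviation_le μ hA hm hε).trans h

/-! ### The laws of the two-group models -/

instance (θ : Param) : IsProbabilityMeasure θ.pairLaw where
  measure_univ := by
    simp only [Param.pairLaw, Measure.add_apply, Measure.smul_apply, measure_univ, smul_eq_mul,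
      mul_one]
    rw [← ENNReal.ofReal_add θ.pi0_mem.1 (by linarith [θ.pi0_mem.2])]
    simp

instance instIsProbabilityMeasureIndepLaw (m : ℕ) (θ : Param) :
    IsProbabilityMeasure (indepLaw m θ) := by
  unfold indepLaw; infer_instance

/-- The uniform distribution on `[0, 1]`. -/
noncomputable abbrev unif : Measure ℝ := (volume : Measure ℝ).restrict (Icc 0 1)

instance : IsProbabilityMeasure unif := ⟨by simp⟩

theorem unif_real_Iic {c : ℝ} (hc : c ∈ Icc (0 : ℝ) 1) : unif.real (Iic c) = c := by
  have : Iic c ∩ Icc 0 1 = Icc 0 c := by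
    ext x; simp only [mem_inter_iff, mem_Iic, mem_Icc]
    exact ⟨fun h => ⟨h.2.1, h.1⟩, fun h => ⟨h.2, h.1, h.2.trans hc.2⟩⟩
  rw [measureReal_restrict_apply measurableSet_Iic, this]
  simp [hc.1]

/-- The map producing the labels and the conformal `p`-values. -/
noncomputable def conformalMap (n m : ℕ) (ω : (Fin n → ℝ) × (Fin m → Bool × ℝ)) (i : Fin m) :
    Bool × ℝ :=
  ((ω.2 i).1, conformalP (fun j => 1 - ω.1 j) (1 - (ω.2 i).2))

theorem conformalLaw_eq (n m : ℕ) (θ : Param) :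
    conformalLaw n m θ =
      ((Measure.pi fun _ : Fin n => unif).prod (indepLaw m θ)).map (conformalMap n m) := rfl

theorem conformalP_eq {n : ℕ} (x : Fin n → ℝ) (q : ℝ) :
    conformalP (fun j => 1 - x j) (1 - q) = (1 + hitCount (Iic q) x) / (n + 1) := by
  unfold conformalP hitCount
  congr 2
  refine Finset.sum_congr rfl fun j _ => ?_
  simp only [indicator_apply, mem_Iic, sub_le_sub_iff_left]

theorem measurable_conformalP {α : Type*} [MeasurableSpace α] {n : ℕ} {S : α → Fin n → ℝ}
    {S' : α → ℝ} (hS : Measurable S) (hS' : Measurable S') :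
    Measurable fun a => conformalP (S a) (S' a) := by
  unfold conformalP
  refine Measurable.div_const (measurable_const.add (Finset.measurable_sum _ fun j _ => ?_)) _
  exact Measurable.ite (measurableSet_le hS' ((measurable_pi_apply j).comp hS))
    measurable_const measurable_const

theorem measurable_conformalMap (n m : ℕ) : Measurable (conformalMap n m) := by
  refine measurable_pi_lambda _ fun i => Measurable.prodMk (by fun_prop) ?_
  exact measurable_conformalP (by fun_prop) (by fun_prop)

instance instIsProbabilityMeasureConformalLaw (n m : ℕ) (θ : Param) :
    IsProbabilityMeasure (conformalLaw n m θ) := by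
  rw [conformalLaw_eq]
  exact Measure.isProbabilityMeasure_map (measurable_conformalMap n m).aemeasurable

instance (s : Setting) (t : s.Index) (θ : Param) : IsProbabilityMeasure (s.law t θ) := by
  cases s
  · exact instIsProbabilityMeasureIndepLaw t θ
  · exact instIsProbabilityMeasureConformalLaw t.1 t.2 θ

theorem pairLaw_real_prod (θ : Param) (B : Set Bool) (C : Set ℝ) :
    θ.pairLaw.real (B ×ˢ C) =
      B.indicator (fun _ => (1 : ℝ)) false * (θ.pi0 * (θ.null : Measure ℝ).real C) +
      B.indicator (fun _ => (1 : ℝ)) true * ((1 - θ.pi0) * (θ.alt : Measure ℝ).real C) := by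
  classical
  have hB : MeasurableSet B := B.toFinite.measurableSet
  have h1 : 0 ≤ 1 - θ.pi0 := by linarith [θ.pi0_mem.2]
  have key : ∀ b : Bool, (Measure.dirac b : Measure Bool) B = if b ∈ B then 1 else 0 := fun b => by
    rw [Measure.dirac_apply' _ hB, indicator_apply]; rfl
  rw [measureReal_def, Param.pairLaw, Measure.add_apply, Measure.smul_apply, Measure.smul_apply,
    Measure.prod_prod, Measure.prod_prod, key, key, ENNReal.toReal_add]
  · by_cases hf : false ∈ B <;> by_cases ht : true ∈ B <;>
      simp [hf, ht, measureReal_def, θ.pi0_mem.1, h1]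
  · rw [smul_eq_mul]; split_ifs <;> finiteness
  · rw [smul_eq_mul]; split_ifs <;> finiteness

theorem pairLaw_real_univ_Iic (θ : Param) (c : ℝ) :
    θ.pairLaw.real (univ ×ˢ Iic c) = θ.mixCDF c := by
  rw [pairLaw_real_prod]
  simp [Param.mixCDF, cdf_eq_real]

theorem pairLaw_real_null_Iic (θ : Param) (c : ℝ) :
    θ.pairLaw.real ({false} ×ˢ Iic c) = θ.pi0 * cdf (θ.null : Measure ℝ) c := by
  rw [pairLaw_real_prod]
  simp [cdf_eq_real]

theorem continuous_pairLaw_real_Iic (θ : Param) (B : Set Bool) :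
    Continuous fun c => θ.pairLaw.real (B ×ˢ Iic c) := by
  simp only [pairLaw_real_prod, ← cdf_eq_real]
  have h0 := θ.null_cont
  have h1 := θ.alt_cont
  fun_prop

theorem real_Iic_one {μ : Measure ℝ} [IsProbabilityMeasure μ] (h : μ (Icc 0 1) = 1) :
    μ.real (Iic 1) = 1 := by
  refine le_antisymm measureReal_le_one ?_
  have : μ.real (Icc 0 1) = 1 := by rw [measureReal_def, h]; rfl
  exact this.ge.trans (measureReal_mono Icc_subset_Iic_self)

theorem Param.cdf_null_one (θ : Param) : cdf (θ.null : Measure ℝ) 1 = 1 := by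
  rw [cdf_eq_real, real_Iic_one θ.null_supp]

theorem pairLaw_real_Iic_one (θ : Param) (B : Set Bool) :
    θ.pairLaw.real (B ×ˢ Iic 1) = θ.pairLaw.real (B ×ˢ univ) := by
  rw [pairLaw_real_prod, pairLaw_real_prod,
    real_Iic_one θ.null_supp, real_Iic_one θ.alt_supp]
  simp

/-- The law of a `p`-value depends on the parameter only through the mixture. -/
theorem pairLaw_map_snd_eq {θ θ' : Param} (h : ∀ y, θ.mixCDF y = θ'.mixCDF y) :
    θ.pairLaw.map Prod.snd = θ'.pairLaw.map Prod.snd := by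
  have hp : ∀ θ : Param, IsProbabilityMeasure (θ.pairLaw.map Prod.snd) := fun θ =>
    Measure.isProbabilityMeasure_map measurable_snd.aemeasurable
  have := hp θ
  refine Measure.ext_of_Iic _ _ fun a => ?_
  have e : ∀ θ : Param, θ.pairLaw.map Prod.snd (Iic a) = ENNReal.ofReal (θ.mixCDF a) := fun θ => by
    rw [Measure.map_apply measurable_snd measurableSet_Iic, ← pairLaw_real_univ_Iic,
      ofReal_measureReal, univ_prod]
  rw [e, e, h]

theorem indepLaw_map_snd (m : ℕ) (θ : Param) :
    (indepLaw m θ).map (fun x i => (x i).2) = Measure.pi fun _ => θ.pairLaw.map Prod.snd := by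
  have : IsProbabilityMeasure (θ.pairLaw.map Prod.snd) :=
    Measure.isProbabilityMeasure_map measurable_snd.aemeasurable
  exact Measure.pi_map_pi (f := fun _ : Fin m => (Prod.snd : Bool × ℝ → ℝ))
    fun _ => measurable_snd.aemeasurable

theorem measurable_pvalues (m : ℕ) : Measurable fun (x : Fin m → Bool × ℝ) i => (x i).2 :=
  measurable_pi_lambda _ fun i => measurable_snd.comp (measurable_pi_apply i)

/-- The law of the `p`-values depends on the parameter only through the mixture. -/
theorem law_map_pvalues_eq (s : Setting) (t : s.Index) {θ θ' : Param}
    (h : ∀ y, θ.mixCDF y = θ'.mixCDF y) :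
    (s.law t θ).map (fun x i => (x i).2) = (s.law t θ').map (fun x i => (x i).2) := by
  cases s
  · change (indepLaw _ θ).map _ = (indepLaw _ θ').map _
    rw [indepLaw_map_snd, indepLaw_map_snd, pairLaw_map_snd_eq h]
  · obtain ⟨n, m⟩ := t
    change (conformalLaw n m θ).map (fun x i => (x i).2) =
      (conformalLaw n m θ').map (fun x i => (x i).2)
    have key : ∀ θ : Param, (conformalLaw n m θ).map (fun x i => (x i).2) =
        ((Measure.pi fun _ : Fin n => unif).prod
          (Measure.pi fun _ : Fin m => θ.pairLaw.map Prod.snd)).map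
          (fun (ω : (Fin n → ℝ) × (Fin m → ℝ)) i =>
            conformalP (fun j => 1 - ω.1 j) (1 - ω.2 i)) := fun θ => by
      -- The conformal `p`-values depend on the calibration sample and the `q_{n+i}` only, so the
      -- labels can be discarded before they are formed.
      rw [← indepLaw_map_snd, conformalLaw_eq,
        Measure.map_map (measurable_pvalues m) (measurable_conformalMap n m)]
      conv_rhs => rw [← Measure.map_id (μ := Measure.pi fun _ : Fin n => unif)]
      rw [Measure.map_prod_map _ _ measurable_id (measurable_pvalues m), Measure.map_map]
      · rfl
      · exact measurable_pi_lambda _ fun i => measurable_conformalP (by fun_prop) (by fun_prop)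
      · exact measurable_id.prodMap (measurable_pvalues m)
    rw [key, key, pairLaw_map_snd_eq h]

/-! ### Law of large numbers for the `p`-values in both settings -/

theorem conformalP_le_one {n : ℕ} (x : Fin n → ℝ) (q : ℝ) :
    conformalP (fun j => 1 - x j) (1 - q) ≤ 1 := by
  rw [conformalP_eq, div_le_one (by positivity)]
  linarith [hitCount_le (Iic q) x]

theorem conformalP_le_of_le {n : ℕ} {x : Fin n → ℝ} {q c κ : ℝ} (hqc : q ≤ c)
    (h : 1 + hitCount (Iic c) x ≤ κ * (n + 1)) :
    conformalP (fun j => 1 - x j) (1 - q) ≤ κ := by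
  rw [conformalP_eq, div_le_iff₀ (by positivity)]
  have : hitCount (Iic q) x ≤ hitCount (Iic c) x := hitCount_le_of_imp fun i hi => hi.trans hqc
  linarith

theorem le_of_conformalP_le {n : ℕ} {x : Fin n → ℝ} {q c κ : ℝ}
    (hp : conformalP (fun j => 1 - x j) (1 - q) ≤ κ)
    (h : κ * (n + 1) < 1 + hitCount (Iic c) x) : q ≤ c := by
  by_contra! hcq
  rw [conformalP_eq, div_le_iff₀ (by positivity)] at hp
  have : hitCount (Iic c) x ≤ hitCount (Iic q) x :=
    hitCount_le_of_imp fun i hi => le_trans hi hcq.le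
  linarith

/-- On the event that the empirical distribution function of the calibration sample is close to
the identity at two points around `κ`, the conformal `p`-values below `κ` are sandwiched. -/
theorem abs_hitCount_conformalMap_sub_le {n m : ℕ} {θ : Param} {B : Set Bool} {κ c₁ c₂ d ε : ℝ}
    (hκ : κ ≤ 1) (hm : 0 < m) (hd : c₁ + 2 * d ≤ κ) (hd' : κ + 2 * d ≤ c₂) (hd0 : 0 < d)
    (hn : 1 ≤ n * d)
    (h₁ : θ.pairLaw.real (B ×ˢ Iic κ) - ε ≤ θ.pairLaw.real (B ×ˢ Iic c₁))
    (h₂ : θ.pairLaw.real (B ×ˢ Iic c₂) ≤ θ.pairLaw.real (B ×ˢ Iic κ) + ε)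
    (hc₁ : c₁ ∈ Icc (0 : ℝ) 1) (hc₂ : c₂ ∈ Icc (0 : ℝ) 1)
    {ω : (Fin n → ℝ) × (Fin m → Bool × ℝ)}
    (hx₁ : |hitCount (Iic c₁) ω.1 / n - unif.real (Iic c₁)| < d)
    (hx₂ : |hitCount (Iic c₂) ω.1 / n - unif.real (Iic c₂)| < d)
    (hq₁ : |hitCount (B ×ˢ Iic c₁) ω.2 / m - θ.pairLaw.real (B ×ˢ Iic c₁)| < ε)
    (hq₂ : |hitCount (B ×ˢ Iic c₂) ω.2 / m - θ.pairLaw.real (B ×ˢ Iic c₂)| < ε) :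
    |hitCount (B ×ˢ Iic κ) (conformalMap n m ω) / m - θ.pairLaw.real (B ×ˢ Iic κ)| < 2 * ε := by
  have hm' : (0 : ℝ) < m := by exact_mod_cast hm
  have hn' : (0 : ℝ) < n := by
    by_contra! h
    nlinarith
  rw [unif_real_Iic hc₁, abs_lt] at hx₁
  rw [unif_real_Iic hc₂, abs_lt] at hx₂
  rw [abs_lt] at hq₁ hq₂ ⊢
  have e₁ : hitCount (Iic c₁) ω.1 < (c₁ + d) * n := by
    rw [← div_lt_iff₀ hn']; linarith
  have e₂ : (c₂ - d) * n < hitCount (Iic c₂) ω.1 := by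
    rw [← lt_div_iff₀ hn']; linarith
  have lower : hitCount (B ×ˢ Iic c₁) ω.2 ≤ hitCount (B ×ˢ Iic κ) (conformalMap n m ω) := by
    refine hitCount_le_of_imp fun i hi => ⟨hi.1, conformalP_le_of_le hi.2 ?_⟩
    -- One margin `d` absorbs the sampling error of the calibration sample; the other, through `1 ≤
    -- n * d`, absorbs the `1 +` in the conformal `p`-value.
    nlinarith [hc₁.1]
  have upper : hitCount (B ×ˢ Iic κ) (conformalMap n m ω) ≤ hitCount (B ×ˢ Iic c₂) ω.2 := by
    refine hitCount_le_of_imp fun i hi => ⟨hi.1, le_of_conformalP_le hi.2 ?_⟩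
    nlinarith [hc₁.1]
  have l' := div_le_div_of_nonneg_right lower hm'.le
  have u' := div_le_div_of_nonneg_right upper hm'.le
  constructor <;> linarith

/-- Continuity of the distribution functions lets `κ` be moved by `2 * d` at a cost of at most `ε`;
`κ < 1` leaves room on the right. -/
theorem exists_near_points (θ : Param) (B : Set Bool) {κ ε : ℝ} (hκ : κ ∈ Ioo (0 : ℝ) 1)
    (hε : 0 < ε) :
    ∃ d > 0, κ - 2 * d ∈ Icc (0 : ℝ) 1 ∧ κ + 2 * d ∈ Icc (0 : ℝ) 1 ∧
      θ.pairLaw.real (B ×ˢ Iic κ) - ε ≤ θ.pairLaw.real (B ×ˢ Iic (κ - 2 * d)) ∧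
      θ.pairLaw.real (B ×ˢ Iic (κ + 2 * d)) ≤ θ.pairLaw.real (B ×ˢ Iic κ) + ε := by
  have hc := continuous_pairLaw_real_Iic θ B
  set G := fun c => θ.pairLaw.real (B ×ˢ Iic c)
  have t₁ : Tendsto (fun d : ℝ => κ - 2 * d) (nhdsWithin 0 (Ioi 0)) (nhds κ) :=
    tendsto_nhdsWithin_of_tendsto_nhds
      ((by fun_prop : Continuous fun d : ℝ => κ - 2 * d).tendsto' 0 κ (by simp))
  have t₂ : Tendsto (fun d : ℝ => κ + 2 * d) (nhdsWithin 0 (Ioi 0)) (nhds κ) :=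
    tendsto_nhdsWithin_of_tendsto_nhds
      ((by fun_prop : Continuous fun d : ℝ => κ + 2 * d).tendsto' 0 κ (by simp))
  have hI : Icc (0 : ℝ) 1 ∈ nhds κ := Icc_mem_nhds hκ.1 hκ.2
  have g₁ := ((hc.tendsto κ).comp t₁).eventually (le_mem_nhds (sub_lt_self (G κ) hε))
  have g₂ := ((hc.tendsto κ).comp t₂).eventually (ge_mem_nhds (lt_add_of_pos_right (G κ) hε))
  obtain ⟨d, h⟩ := ((eventually_mem_nhdsWithin (s := Ioi (0 : ℝ)) (a := 0)).and
    ((t₁.eventually hI).and ((t₂.eventually hI).and (g₁.and g₂)))).exists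
  exact ⟨d, h.1, h.2.1, h.2.2.1, h.2.2.2.1, h.2.2.2.2⟩

/-- A union bound over two bad events for the calibration sample and two for the test sample, each
evaluated under its own marginal. -/
theorem conformalLaw_real_le (n m : ℕ) (θ : Param) {S : Set (Fin m → Bool × ℝ)}
    (hS : MeasurableSet S) {A A' : Set (Fin n → ℝ)} {C C' : Set (Fin m → Bool × ℝ)}
    (h : conformalMap n m ⁻¹' S ⊆ Prod.fst ⁻¹' A ∪ Prod.fst ⁻¹' A' ∪ Prod.snd ⁻¹' C ∪
      Prod.snd ⁻¹' C') :
    (conformalLaw n m θ).real S ≤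
      (Measure.pi fun _ : Fin n => unif).real A + (Measure.pi fun _ : Fin n => unif).real A' +
        (indepLaw m θ).real C + (indepLaw m θ).real C' := by
  rw [conformalLaw_eq, map_measureReal_apply (measurable_conformalMap n m) hS]
  have hf : ∀ A : Set (Fin n → ℝ),
      ((Measure.pi fun _ : Fin n => unif).prod (indepLaw m θ)).real (Prod.fst ⁻¹' A) =
        (Measure.pi fun _ : Fin n => unif).real A := fun A => by
    rw [← prod_univ, measureReal_prod_prod]; simp
  have hs : ∀ C : Set (Fin m → Bool × ℝ),
      ((Measure.pi fun _ : Fin n => unif).prod (indepLaw m θ)).real (Prod.snd ⁻¹' C) =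
        (indepLaw m θ).real C := fun C => by
    rw [← univ_prod, measureReal_prod_prod]; simp
  rw [← hf A, ← hf A', ← hs C, ← hs C']
  refine (measureReal_mono h).trans ((measureReal_union_le _ _).trans ?_)
  gcongr
  refine (measureReal_union_le _ _).trans ?_
  gcongr
  exact measureReal_union_le _ _

theorem measurableSet_deviation (m : ℕ) {A : Set (Bool × ℝ)} (hA : MeasurableSet A) (c ε : ℝ) :
    MeasurableSet {x : Fin m → Bool × ℝ | ε ≤ |hitCount A x / m - c|} :=
  measurableSet_le measurable_const
    (continuous_abs.measurable.comp (((measurable_hitCount m hA).div_const _).sub_const _))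

theorem measurableSet_prod_Iic (B : Set Bool) (c : ℝ) : MeasurableSet (B ×ˢ Iic c) :=
  B.toFinite.measurableSet.prod measurableSet_Iic

theorem eventually_conformalLaw_deviation_le (θ : Param) (B : Set Bool) {κ ε ρ : ℝ}
    (hκ : κ ∈ Ioc (0 : ℝ) 1) (hε : 0 < ε) (hρ : 0 < ρ) :
    ∀ᶠ t : ℕ × ℕ in atTop, (conformalLaw t.1 t.2 θ).real
      {x | ε ≤ |hitCount (B ×ˢ Iic κ) x / t.2 - θ.pairLaw.real (B ×ˢ Iic κ)|} ≤ ρ := by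
  rw [← prod_atTop_atTop_eq]
  have hm := (eventually_gt_atTop 0).prod_inr (atTop : Filter ℕ)
  rcases hκ.2.lt_or_eq with hκ1 | rfl
  · obtain ⟨d, hd, hc₁, hc₂, h₁, h₂⟩ := exists_near_points θ B ⟨hκ.1, hκ1⟩ (half_pos hε)
    have hρ4 : 0 < ρ / 4 := by positivity
    have a := fun c => (eventually_pi_real_hitCount_deviation_le unif
      (measurableSet_Iic (a := c)) hd hρ4).prod_inl (atTop : Filter ℕ)
    have b := fun c => (eventually_pi_real_hitCount_deviation_le θ.pairLaw
      (measurableSet_prod_Iic B c) (half_pos hε) hρ4).prod_inr (atTop : Filter ℕ)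
    have hn : ∀ᶠ n : ℕ in atTop, 1 ≤ n * d :=
      (tendsto_natCast_atTop_atTop.atTop_mul_const hd).eventually_ge_atTop 1
    filter_upwards [a (κ - 2 * d), a (κ + 2 * d), b (κ - 2 * d), b (κ + 2 * d), hm,
      hn.prod_inl (atTop : Filter ℕ)] with t a₁ a₂ b₁ b₂ hm hn
    refine (conformalLaw_real_le t.1 t.2 θ
      (measurableSet_deviation _ (measurableSet_prod_Iic B κ) _ _) ?_).trans
      ((add_le_add (add_le_add (add_le_add a₁ a₂) b₁) b₂).trans_eq (by ring))
    intro ω hω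
    by_contra hcon
    simp only [mem_union, mem_preimage, mem_ofPred_eq, not_or, not_le] at hcon hω
    have := abs_hitCount_conformalMap_sub_le hκ.2 hm (by linarith) le_rfl hd hn h₁ h₂ hc₁ hc₂
      hcon.1.1.1 hcon.1.1.2 hcon.1.2 hcon.2
    linarith
  -- At `κ = 1` there is no room to the right, but every conformal `p`-value is at most `1`, so only
  -- the labels are counted and no calibration event is needed.
  · have b := (eventually_pi_real_hitCount_deviation_le θ.pairLaw
      (B.toFinite.measurableSet.prod MeasurableSet.univ) hε hρ).prod_inr (atTop : Filter ℕ)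
    filter_upwards [b] with t b
    refine (conformalLaw_real_le t.1 t.2 θ (A := ∅) (A' := ∅)
      (C := {x | ε ≤ |hitCount (B ×ˢ univ) x / t.2 - θ.pairLaw.real (B ×ˢ univ)|}) (C' := ∅)
      (measurableSet_deviation _ (measurableSet_prod_Iic B 1) _ _) ?_).trans
      ((by simp [indepLaw] : _ = _).trans_le b)
    intro ω hω
    have : hitCount (B ×ˢ Iic 1) (conformalMap t.1 t.2 ω) = hitCount (B ×ˢ univ) ω.2 :=
      le_antisymm (hitCount_le_of_imp fun i hi => ⟨hi.1, mem_univ _⟩)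
        (hitCount_le_of_imp fun i hi => ⟨hi.1, conformalP_le_one _ _⟩)
    simp only [mem_preimage, mem_ofPred_eq, this, pairLaw_real_Iic_one] at hω
    simpa using hω

theorem eventually_law_deviation_le (s : Setting) (θ : Param) (B : Set Bool) {κ ε ρ : ℝ}
    (hκ : κ ∈ Ioc (0 : ℝ) 1) (hε : 0 < ε) (hρ : 0 < ρ) :
    ∀ᶠ t in atTop, (s.law t θ).real
      {x | ε ≤ |hitCount (B ×ˢ Iic κ) x / s.size t - θ.pairLaw.real (B ×ˢ Iic κ)|} ≤ ρ := by
  cases s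
  · exact eventually_pi_real_hitCount_deviation_le θ.pairLaw (measurableSet_prod_Iic B κ) hε hρ
  · exact eventually_conformalLaw_deviation_le θ B hκ hε hρ

theorem eventually_admissible (s : Setting) : ∀ᶠ t in atTop, s.Admissible t := by
  cases s
  · exact eventually_ge_atTop (2 : ℕ)
  · exact (eventually_ge_atTop ((1, 2) : ℕ × ℕ)).mono fun t h => h

theorem atTop_neBot (s : Setting) : (atTop : Filter s.Index).NeBot := by
  cases s
  · exact inferInstanceAs (atTop : Filter ℕ).NeBot
  · exact inferInstanceAs (atTop : Filter (ℕ × ℕ)).NeBot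

theorem Setting.Admissible.size_pos {s : Setting} {t : s.Index} (h : s.Admissible t) :
    0 < s.size t := by
  cases s
  · exact Nat.lt_of_lt_of_le two_pos h
  · exact Nat.lt_of_lt_of_le two_pos h.2

namespace Setting

variable {s : Setting} {t : s.Index} {e : (Fin (s.size t) → ℝ) → ℝ}

/-! ### False discovery rate and power as integrals -/

theorem measurable_count_rejected (he : Measurable e) (b : Bool) (α κ : ℝ) :
    Measurable fun x : Fin (s.size t) → Bool × ℝ => ∑ i, if (x i).1 = b ∧
      (x i).2 ≤ threshold α κ (e fun j => (x j).2) (fun j => (x j).2) then (1 : ℝ) else 0 := by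
  refine Finset.measurable_sum _ fun i _ => Measurable.ite ?_ measurable_const measurable_const
  refine MeasurableSet.inter ?_ ?_
  · exact (measurable_fst.comp (measurable_pi_apply i)) (measurableSet_singleton b)
  · exact measurableSet_le (measurable_snd.comp (measurable_pi_apply i))
      ((measurable_threshold α κ he).comp (measurable_pvalues _))

theorem count_rejected_mem (b : Bool) (c : ℝ) (x : Fin (s.size t) → Bool × ℝ) :
    (∑ i, if (x i).1 = b ∧ (x i).2 ≤ c then (1 : ℝ) else 0) ∈ Icc (0 : ℝ) (s.size t) := by
  constructor
  · exact Finset.sum_nonneg fun i _ => by split_ifs <;> simp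
  · calc _ ≤ ∑ _i : Fin (s.size t), (1 : ℝ) :=
          Finset.sum_le_sum fun i _ => by split_ifs <;> simp
      _ = s.size t := by simp

theorem integrable_of_mem_Icc {Ω : Type*} [MeasurableSpace Ω] {μ : Measure Ω}
    [IsFiniteMeasure μ] {f : Ω → ℝ} (hf : Measurable f) {C : ℝ} (h : ∀ x, f x ∈ Icc 0 C) :
    Integrable f μ :=
  Integrable.of_bound hf.aestronglyMeasurable C
    (ae_of_all _ fun x => by rw [Real.norm_of_nonneg (h x).1]; exact (h x).2)

/-- Markov's inequality for the nonnegative false discovery proportion. -/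
theorem mul_real_le_fdr (θ : Param) (he : Measurable e) (α κ : ℝ)
    {E : Set (Fin (s.size t) → Bool × ℝ)} (hE : MeasurableSet E) {c : ℝ}
    (h : ∀ x ∈ E, c ≤ (∑ i, if (x i).1 = false ∧
        (x i).2 ≤ threshold α κ (e fun j => (x j).2) (fun j => (x j).2) then (1 : ℝ) else 0) /
      max (numRej α κ (e fun j => (x j).2) (fun j => (x j).2) : ℝ) 1) :
    c * (s.law t θ).real E ≤ s.fdr t θ e α κ := by
  have h1 : ∫ x, E.indicator (fun _ => c) x ∂(s.law t θ) = c * (s.law t θ).real E := by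
    rw [integral_indicator_const _ hE, smul_eq_mul, mul_comm]
  rw [← h1]
  refine integral_mono ((integrable_const c).indicator hE)
    (integrable_of_mem_Icc (C := s.size t) ?_ fun x => ?_) fun x => ?_
  · refine (measurable_count_rejected he false α κ).div (Measurable.max ?_ measurable_const)
    exact measurable_from_nat.comp ((measurable_numRej α κ he).comp (measurable_pvalues _))
  · have := count_rejected_mem (s := s) (t := t) false
      (threshold α κ (e fun j => (x j).2) (fun j => (x j).2)) x
    exact ⟨div_nonneg this.1 (by positivity),
      (div_le_self this.1 (le_max_right _ _)).trans this.2⟩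
  · by_cases hx : x ∈ E
    · simpa [hx] using h x hx
    · simp only [hx, not_false_eq_true, indicator_of_notMem]
      exact div_nonneg (count_rejected_mem _ _ x).1 (by positivity)

/-- On `E` the first procedure rejects a subset of what the second rejects; off `E` the two
proportions of true discoveries differ by at most one. -/
theorem power_sub_le (θ : Param) {e' : (Fin (s.size t) → ℝ) → ℝ} (he : Measurable e)
    (he' : Measurable e') (α κ α' κ' : ℝ) {E : Set (Fin (s.size t) → Bool × ℝ)}
    (hE : MeasurableSet E)
    (h : ∀ x ∈ E, threshold α κ (e fun j => (x j).2) (fun j => (x j).2) ≤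
      threshold α' κ' (e' fun j => (x j).2) (fun j => (x j).2)) :
    s.power t θ e α κ - s.power t θ e' α' κ' ≤ (s.law t θ).real Eᶜ := by
  have hint : ∀ {e : (Fin (s.size t) → ℝ) → ℝ}, Measurable e → ∀ α κ : ℝ,
      Integrable (fun x : Fin (s.size t) → Bool × ℝ => (∑ i, if (x i).1 = true ∧
        (x i).2 ≤ threshold α κ (e fun j => (x j).2) (fun j => (x j).2) then (1 : ℝ) else 0) /
      (s.size t : ℝ)) (s.law t θ) := fun he α κ =>
    integrable_of_mem_Icc (C := 1) ((measurable_count_rejected he true α κ).div_const _)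
      fun x => ⟨div_nonneg (count_rejected_mem _ _ x).1 (Nat.cast_nonneg _),
        div_le_one_of_le₀ (count_rejected_mem _ _ x).2 (Nat.cast_nonneg _)⟩
  have h1 : ∫ x, Eᶜ.indicator (fun _ => (1 : ℝ)) x ∂(s.law t θ) = (s.law t θ).real Eᶜ :=
    integral_indicator_one hE.compl
  rw [power, power, ← integral_sub (hint he α κ) (hint he' α' κ'), ← h1]
  refine integral_mono ((hint he α κ).sub (hint he' α' κ'))
    ((integrable_const 1).indicator hE.compl) fun x => ?_
  by_cases hx : x ∈ E
  · simp only [mem_compl_iff, hx, not_true_eq_false, not_false_eq_true, indicator_of_notMem,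
      sub_nonpos]
    gcongr with i
    split_ifs with h1 h2 h2
    · exact le_rfl
    · exact absurd ⟨h1.1, h1.2.trans (h x hx)⟩ h2
    · exact zero_le_one
    · exact le_rfl
  · simp only [mem_compl_iff, hx, not_false_eq_true, indicator_of_mem]
    have a : _ / (s.size t : ℝ) ≤ 1 := div_le_one_of_le₀ (count_rejected_mem (s := s) (t := t) true
      (threshold α κ (e fun j => (x j).2) (fun j => (x j).2)) x).2 (Nat.cast_nonneg _)
    have b : 0 ≤ _ / (s.size t : ℝ) := div_nonneg (count_rejected_mem (s := s) (t := t) true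
      (threshold α' κ' (e' fun j => (x j).2) (fun j => (x j).2)) x).1 (Nat.cast_nonneg _)
    linarith

theorem law_real_pvalues_eq {θ θ' : Param} (h : ∀ y, θ.mixCDF y = θ'.mixCDF y)
    {T : Set (Fin (s.size t) → ℝ)} (hT : MeasurableSet T) :
    (s.law t θ).real {x | (fun i => (x i).2) ∈ T} =
      (s.law t θ').real {x | (fun i => (x i).2) ∈ T} := by
  have key : ∀ θ : Param, (s.law t θ).real {x | (fun i => (x i).2) ∈ T} =
      ((s.law t θ).map fun x i => (x i).2).real T := fun θ =>
    (map_measureReal_apply (measurable_pvalues _) hT).symm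
  rw [key, key, law_map_pvalues_eq s t h]

/-! ### Concentration points of FDR-conservative estimators -/

/-- With more than `(F - ε) m` of the `p`-values below `κ`, the condition `κ b ≤ α (F - ε)` pushes
the critical value up to the cap. All `p`-values below `κ` are then rejected, fewer than `(F + ε) m`
in number, and more than `(v - ε) m` of them are true nulls. -/
theorem le_false_discovery_proportion {m : ℕ} {α κ π F v ε : ℝ} (hκ : 0 < κ) (hα : 0 ≤ α)
    (hm : 0 < m) (hεF : ε < F) (hε : 0 < ε) (hv : ε < v) (x : Fin m → Bool × ℝ) {b : ℝ}
    (hπ : 0 ≤ π) (hπb : π ≤ b) (hb : κ * b ≤ α * (F - ε))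
    (hR : |hitCount (univ ×ˢ Iic κ) x / m - F| < ε)
    (hV : |hitCount ({false} ×ˢ Iic κ) x / m - v| < ε) :
    (v - ε) / (F + ε) ≤ (∑ i, if (x i).1 = false ∧
        (x i).2 ≤ threshold α κ π (fun j => (x j).2) then (1 : ℝ) else 0) /
      max (numRej α κ π (fun j => (x j).2) : ℝ) 1 := by
  classical
  have hm' : (0 : ℝ) < m := by exact_mod_cast hm
  rw [abs_lt] at hR hV
  have eR : hitCount (univ ×ˢ Iic κ) x =
      ((Finset.univ.filter fun i => (x i).2 ≤ κ).card : ℝ) := by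
    simp [hitCount, indicator_apply, Finset.sum_boole]
  set R := (Finset.univ.filter fun i => (x i).2 ≤ κ).card with hRdef
  rw [eR] at hR
  have hR1 : (F - ε) * m < R := by
    rw [← lt_div_iff₀ hm']; linarith
  have hR2 : (R : ℝ) < (F + ε) * m := by
    rw [← div_lt_iff₀ hm']; linarith
  have hV1 : (v - ε) * m < hitCount ({false} ×ˢ Iic κ) x := by
    rw [← lt_div_iff₀ hm']; linarith
  have hRpos : (0 : ℝ) < R := lt_trans (mul_pos (by linarith) hm') hR1
  have hRpos' : 0 < R := by exact_mod_cast hRpos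
  obtain ⟨hk, ht⟩ := numRej_eq_card (α := α) (π := π) hκ.le (fun j => (x j).2) hRpos' (by
    intro h0
    have hπ0 : 0 < π := lt_of_le_of_ne hπ (Ne.symm h0)
    rw [le_div_iff₀ (by positivity)]
    calc κ * (m * π) = κ * π * m := by ring
      _ ≤ κ * b * m := by gcongr
      _ ≤ α * (F - ε) * m := by gcongr
      _ = α * ((F - ε) * m) := by ring
      _ ≤ α * R := by gcongr)
  have eV : (∑ i, if (x i).1 = false ∧ (x i).2 ≤ κ then (1 : ℝ) else 0) =
      hitCount ({false} ×ˢ Iic κ) x :=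
    Finset.sum_congr rfl fun i _ => by simp [indicator_apply]
  rw [hk, ht, eV, max_eq_left (by exact_mod_cast hRpos'), div_le_div_iff₀ (by linarith) hRpos]
  have hvε : 0 < v - ε := by linarith
  calc (v - ε) * R ≤ (v - ε) * ((F + ε) * m) := by gcongr
    _ = (v - ε) * m * (F + ε) := by ring
    _ ≤ _ := by gcongr; linarith

/-- All the inequalities are strict at `ε = 0` and persist by continuity. The factor `1 - 3 * ε`
pays for three exceptional events: failure of concentration and two count deviations. -/
theorem exists_margin {α κ b F v : ℝ} (hκb : κ * b < α * F) (hα : α < v / F) (hF : 0 < F)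
    (hv : 0 < v) :
    ∃ ε > 0, ε < F ∧ ε < v ∧ κ * (b + ε) ≤ α * (F - ε) ∧
      α < (v - ε) / (F + ε) * (1 - 3 * ε) := by
  have c₁ : Tendsto (fun ε : ℝ => α * (F - ε) - κ * (b + ε)) (nhds 0) (nhds (α * F - κ * b)) :=
    (by fun_prop : Continuous fun ε : ℝ => α * (F - ε) - κ * (b + ε)).tendsto' _ _ (by simp)
  have c₂ : Tendsto (fun ε : ℝ => (v - ε) / (F + ε) * (1 - 3 * ε)) (nhds 0) (nhds (v / F)) := by
    have : ContinuousAt (fun ε : ℝ => (v - ε) / (F + ε) * (1 - 3 * ε)) 0 :=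
      ContinuousAt.mul (ContinuousAt.div (by fun_prop) (by fun_prop) (by simp [hF.ne']))
        (by fun_prop)
    simpa [ContinuousAt] using this
  have e₁ := c₁.eventually (lt_mem_nhds (sub_pos.2 hκb))
  have e₂ := c₂.eventually (lt_mem_nhds hα)
  have e₃ := e₁.and (e₂.and ((eventually_lt_nhds hF).and (eventually_lt_nhds hv)))
  obtain ⟨ε, h, hε⟩ := ((e₃.filter_mono nhdsWithin_le_nhds).and
    (eventually_mem_nhdsWithin (s := Ioi (0 : ℝ)) (a := 0))).exists
  exact ⟨ε, hε, h.2.2.1, h.2.2.2, by linarith [h.1], h.2.1⟩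

/-- An estimator which is FDR-conservative under `θ'` cannot concentrate below the null proportion
of `θ'`, even if it concentrates under a parameter `θ` with the same mixture. -/
theorem pi0_le_of_fdr_le (s : Setting) {θ θ' : Param} (hmix : ∀ y, θ.mixCDF y = θ'.mixCDF y)
    (e : s.Estimator) {κ : ℝ} (hκ : κ ∈ Ioc (0 : ℝ) 1)
    (hnull : cdf (θ'.null : Measure ℝ) κ = κ)
    (hfdr : ∀ α ∈ Ioo (0 : ℝ) 1, ∀ t, s.Admissible t → s.fdr t θ' (e.est t) α κ ≤ α)
    {b : ℝ} (hb : 0 < b) {η δ : s.Index → ℝ} (hη : Tendsto η atTop (nhds 0))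
    (hδ : Tendsto δ atTop (nhds 0))
    (hconc : ∀ᶠ t in atTop,
      1 - δ t ≤ (s.law t θ).real {x | |e.est t (fun i => (x i).2) - b| ≤ η t}) :
    θ'.pi0 ≤ b := by
  by_contra! hlt
  set F := θ'.mixCDF κ with hF
  have hvF : θ'.pi0 * κ ≤ F := by
    rw [hF, Param.mixCDF, hnull]
    have := mul_nonneg (sub_nonneg.2 θ'.pi0_mem.2) (cdf_nonneg (θ'.alt : Measure ℝ) κ)
    linarith
  have hv : 0 < θ'.pi0 * κ := mul_pos (hb.trans hlt) hκ.1
  have hFpos : 0 < F := hv.trans_le hvF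
  -- The level lies between `b κ / F` and `π₀' κ / F`: above the first the cap is reached, below the
  -- second the false discovery proportion exceeds `α`.
  obtain ⟨α, hα₁, hα₂⟩ := exists_between
    (div_lt_div_of_pos_right (mul_lt_mul_of_pos_right hlt hκ.1) hFpos)
  have hα0 : 0 < α := (div_pos (mul_pos hb hκ.1) hFpos).trans hα₁
  have hα1 : α < 1 := hα₂.trans_le ((div_le_one hFpos).2 hvF)
  rw [div_lt_iff₀ hFpos] at hα₁
  obtain ⟨ε, hε, hεF, hεv, hcrit, hgain⟩ := exists_margin (mul_comm b κ ▸ hα₁) hα₂ hFpos hv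
  have hdev := fun B => eventually_law_deviation_le s θ' B hκ hε hε
  have := atTop_neBot s
  -- FDR control is assumed at every admissible `t`, so a single large `t` suffices for the
  -- contradiction.
  obtain ⟨t, hadm, hc, hηt, hδt, hR, hV⟩ := ((eventually_admissible s).and (hconc.and
    ((hη.eventually (ge_mem_nhds hε)).and ((hδ.eventually (ge_mem_nhds hε)).and
      ((hdev univ).and (hdev {false})))))).exists
  have hT : MeasurableSet {p : Fin (s.size t) → ℝ | |e.est t p - b| ≤ η t} :=
    measurableSet_le (continuous_abs.measurable.comp ((e.measurable_est t).sub_const _))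
      measurable_const
  -- Concentration is known under `θ` but FDR control is used under `θ'`; the event involves only
  -- the `p`-values, whose law is the same.
  have hconc' : 1 - δ t ≤ (s.law t θ').real {x | |e.est t (fun i => (x i).2) - b| ≤ η t} :=
    hc.trans_eq (law_real_pvalues_eq hmix hT)
  set A := {x : Fin (s.size t) → Bool × ℝ | |e.est t (fun i => (x i).2) - b| ≤ η t} with hA
  have hAm : MeasurableSet A := (measurable_pvalues _) hT
  rw [pairLaw_real_univ_Iic] at hR
  rw [pairLaw_real_null_Iic, hnull] at hV
  set D := {x : Fin (s.size t) → Bool × ℝ |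
    ε ≤ |hitCount (univ ×ˢ Iic κ) x / (s.size t : ℝ) - F|} with hD
  set D' := {x : Fin (s.size t) → Bool × ℝ |
    ε ≤ |hitCount ({false} ×ˢ Iic κ) x / (s.size t : ℝ) - θ'.pi0 * κ|} with hD'
  have hDm : MeasurableSet D := measurableSet_deviation _ (measurableSet_prod_Iic _ _) _ _
  have hDm' : MeasurableSet D' := measurableSet_deviation _ (measurableSet_prod_Iic _ _) _ _
  have hEm : MeasurableSet (A \ (D ∪ D')) := hAm.diff (hDm.union hDm')
  have hprob : 1 - 3 * ε ≤ (s.law t θ').real (A \ (D ∪ D')) := by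
    have h1 := le_measureReal_sdiff (μ := s.law t θ') (s₁ := A) (s₂ := D ∪ D')
    have h2 := measureReal_union_le (μ := s.law t θ') D D'
    linarith
  have hle := mul_real_le_fdr (s := s) (t := t) θ' (e.measurable_est t) α κ hEm
    (c := (θ'.pi0 * κ - ε) / (F + ε)) (by
      rintro x ⟨hxA, hxD⟩
      simp only [hD, hD', mem_union, mem_ofPred_eq, not_or, not_le] at hxD
      refine le_false_discovery_proportion hκ.1 hα0.le hadm.size_pos hεF hε hεv x
        (e.nonneg_est t _) (b := b + ε) ?_ hcrit hxD.1 hxD.2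
      have : |e.est t (fun i => (x i).2) - b| ≤ η t := hxA
      have := (abs_le.1 this).2
      linarith)
  have hfin := hfdr α ⟨hα0, hα1⟩ t hadm
  have hc0 : 0 ≤ (θ'.pi0 * κ - ε) / (F + ε) := div_nonneg (by linarith) (by linarith)
  have := mul_le_mul_of_nonneg_left hprob hc0
  linarith

theorem piStar_le_piBar (s : Setting) {Θ : Set Param}
    (hmax : ∀ θ ∈ Θ, IsGreatest (nullProportions Θ θ) (piStar Θ θ)) {κ : ℝ}
    (hκ : κ ∈ Ioc (0 : ℝ) 1) (hnull : κ = 1 ∨ ∀ θ ∈ Θ, θ.HasUniformNull) {e : s.Estimator}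
    {piBar : Param → ℝ} {η δ : s.Index → Param → ℝ} (hfdr : s.FDRConservative Θ e κ)
    (hconc : s.Concentrating Θ e piBar η δ) {θ : Param} (hθ : θ ∈ Θ) :
    piStar Θ θ ≤ piBar θ := by
  -- The maximum is attained, so some `θ'` in `Θ` has the mixture of `θ` and null proportion exactly
  -- `π*`.
  obtain ⟨_, θ', hθ', hπ, hmix⟩ := (hmax θ hθ).1
  obtain ⟨hη, hδ, h⟩ := hconc
  rw [← hπ]
  refine pi0_le_of_fdr_le s hmix e hκ ?_ (fun α hα t ht => hfdr α hα t ht θ' hθ') (h θ hθ).1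
    (hη θ hθ).2 (hδ θ hθ).2 (h θ hθ).2
  rcases hnull with rfl | hu
  · exact θ'.cdf_null_one
  · exact hu θ' hθ' κ (Ioc_subset_Icc_self hκ)

/-! ### Comparison of powers -/

/-- This is `(1 - r/π)(π + r) = π - r²/π ≤ π`, the reason for the form of the correction factors in
`α'` and `α''`. -/
theorem one_sub_div_div_le {π r : ℝ} (hπ : 0 < π) (hr : 0 ≤ r) :
    (1 - r / π) / π ≤ 1 / (π + r) := by
  rw [div_le_div_iff₀ hπ (by positivity)]
  have : (1 - r / π) * (π + r) = π - r ^ 2 / π := by field_simp; ring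
  rw [this]
  linarith [div_nonneg (sq_nonneg r) hπ.le]

theorem one_sub_div_sub_div_le {π r : ℝ} (hr : 0 ≤ r) (h : r < π) :
    (1 - r / (π - r)) / (π - r) ≤ 1 / π := by
  have := one_sub_div_div_le (sub_pos.2 h) hr
  rwa [sub_add_cancel] at this

theorem oracle_level_ratio_le {α π r : ℝ} (hα : 0 ≤ α) (hπ : 0 < π) (hr : 0 ≤ r) :
    α * (1 - r / π) / π ≤ α / (π + r) := by
  rw [mul_div_assoc, div_eq_mul_one_div α]
  exact mul_le_mul_of_nonneg_left (one_sub_div_div_le hπ hr) hα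

/-- The factor in `r` replaces `π - r` by `π`, and the factor in `r'` then replaces `π` by `π + r'`.
The conditions `r' ≤ π` and `2 * r ≤ π` keep both factors nonnegative. -/
theorem level_ratio_le {α π r r' p : ℝ} (hα : 0 ≤ α) (hr' : 0 ≤ r') (hr : 0 ≤ r)
    (hrπ : r' ≤ π) (h2 : 2 * r ≤ π) (hπ : 0 < π) (hp : π - r ≤ p) :
    α * (1 - r' / π) * (1 - r / (π - r)) / p ≤ α / (π + r') := by
  have hpos : 0 < π - r := by linarith
  have ha : 0 ≤ 1 - r' / π := by rw [sub_nonneg, div_le_one hπ]; exact hrπ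
  have hb : 0 ≤ 1 - r / (π - r) := by rw [sub_nonneg, div_le_one hpos]; linarith
  calc _ ≤ α * (1 - r' / π) * (1 - r / (π - r)) / (π - r) := by gcongr
    _ = α * (1 - r' / π) * ((1 - r / (π - r)) / (π - r)) := by ring
    _ ≤ α * (1 - r' / π) * (1 / π) := by
        exact mul_le_mul_of_nonneg_left (one_sub_div_sub_div_le hr (sub_pos.1 hpos))
          (mul_nonneg hα ha)
    _ = α * (1 - r' / π) / π := by ring
    _ ≤ _ := oracle_level_ratio_le hα hπ hr'

theorem cap_of_le {α κ π r : ℝ} (hκ : 0 ≤ κ) (hπ : 0 < π) (hr : 0 ≤ r)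
    (h : 1 ≤ κ ∨ α ≤ κ * π) : 1 ≤ κ ∨ α / (π + r) ≤ κ := by
  refine h.imp id fun h => ?_
  rw [div_le_iff₀ (by positivity)]
  nlinarith

theorem measurableSet_est_le (e : s.Estimator) (c : ℝ) :
    MeasurableSet {x : Fin (s.size t) → Bool × ℝ | e.est t (fun i => (x i).2) ≤ c} :=
  measurableSet_le ((e.measurable_est t).comp (measurable_pvalues _)) measurable_const

/-- The good event depends on neither `α` nor `κ`, so these are quantified after `t`; this makes the
bound uniform in the level, as the supremum requires. -/
theorem eventually_oracle_power_sub_le {Θ : Set Param}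
    (hmax : ∀ θ ∈ Θ, IsGreatest (nullProportions Θ θ) (piStar Θ θ))
    {piHat : s.Estimator} {ηs δs : s.Index → Param → ℝ}
    (hHat : s.ConcentratesBelow Θ piHat ηs δs) {θ : Param} (hθ : θ ∈ Θ) :
    ∀ᶠ t in atTop, ∀ α κ : ℝ, 0 ≤ α → 0 ≤ κ → (1 ≤ κ ∨ α ≤ κ * piStar Θ θ) →
      s.power t θ (fun _ => piStar Θ θ) (α * (1 - ηs t θ / piStar Θ θ)) 1 -
        s.power t θ (piHat.est t) α κ ≤ δs t θ := by
  have hπ : 0 < piStar Θ θ := (hmax θ hθ).1.1.1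
  obtain ⟨hηs, -, h⟩ := hHat
  filter_upwards [h θ hθ] with t ht α κ hα hκ hcap
  have hr := (hηs θ hθ).1 t
  have hE := measurableSet_est_le (t := t) piHat (piStar Θ θ + ηs t θ)
  refine (power_sub_le θ measurable_const (piHat.measurable_est t) _ _ _ _ hE
    fun x hx => ?_).trans ?_
  · exact threshold_le_of_ratio_le _ hκ zero_le_one hα (piHat.nonneg_est t _) hπ hx
      (oracle_level_ratio_le hα hπ hr) (cap_of_le hκ hπ hr hcap)
  · rw [probReal_compl_eq_one_sub hE]
    linarith

theorem eventually_power_sub_le {Θ : Set Param}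
    (hmax : ∀ θ ∈ Θ, IsGreatest (nullProportions Θ θ) (piStar Θ θ))
    {piHat : s.Estimator} {ηs δs : s.Index → Param → ℝ}
    (hHat : s.ConcentratesBelow Θ piHat ηs δs) {piTilde : s.Estimator} {piBar : Param → ℝ}
    {η δ : s.Index → Param → ℝ} (hconc : s.Concentrating Θ piTilde piBar η δ) {θ : Param}
    (hθ : θ ∈ Θ) (hbar : piStar Θ θ ≤ piBar θ) :
    ∀ᶠ t in atTop, ∀ α κ : ℝ, 0 ≤ α → 0 ≤ κ → (1 ≤ κ ∨ α ≤ κ * piStar Θ θ) →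
      s.power t θ (piTilde.est t)
          (α * (1 - ηs t θ / piStar Θ θ) * (1 - η t θ / (piStar Θ θ - η t θ))) 1 -
        s.power t θ (piHat.est t) α κ ≤ δs t θ + δ t θ := by
  have hπ : 0 < piStar Θ θ := (hmax θ hθ).1.1.1
  obtain ⟨hηs, -, h⟩ := hHat
  obtain ⟨hη, -, h'⟩ := hconc
  -- Beyond the two concentration bounds, `t` must be large enough for `η* ≤ π*` and `η ≤ π* / 2`,
  -- which keeps `α'` nonnegative and `π* - η` positive.
  filter_upwards [h θ hθ, (h' θ hθ).2, (hηs θ hθ).2.eventually (ge_mem_nhds hπ),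
    (hη θ hθ).2.eventually (ge_mem_nhds (half_pos hπ))] with t ht ht' hs1 hs2 α κ hα hκ hcap
  have hr := (hηs θ hθ).1 t
  have hr' := (hη θ hθ).1 t
  set A := {x : Fin (s.size t) → Bool × ℝ |
    piHat.est t (fun i => (x i).2) ≤ piStar Θ θ + ηs t θ}
  set A' := {x : Fin (s.size t) → Bool × ℝ |
    |piTilde.est t (fun i => (x i).2) - piBar θ| ≤ η t θ}
  have hA : MeasurableSet A := measurableSet_est_le piHat _
  have hA' : MeasurableSet A' :=
    measurableSet_le (continuous_abs.measurable.comp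
      (((piTilde.measurable_est t).comp (measurable_pvalues _)).sub_const _)) measurable_const
  refine (power_sub_le θ (piTilde.measurable_est t) (piHat.measurable_est t) _ _ _ _
    (hA.inter hA') fun x hx => ?_).trans ?_
  -- The inequality `π* ≤ π̄` enters only here: an estimate within `η` of `π̄` is at least `π* - η`.
  · have hp : piStar Θ θ - η t θ ≤ piTilde.est t (fun i => (x i).2) := by
      have : |piTilde.est t (fun i => (x i).2) - piBar θ| ≤ η t θ := hx.2
      have := (abs_le.1 this).1
      linarith
    exact threshold_le_of_ratio_le _ hκ zero_le_one hα (piHat.nonneg_est t _) (by linarith) hx.1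
      (level_ratio_le hα hr hr' hs1 (by linarith) hπ hp) (cap_of_le hκ hπ hr hcap)
  · rw [compl_inter]
    refine (measureReal_union_le _ _).trans ?_
    rw [probReal_compl_eq_one_sub hA, probReal_compl_eq_one_sub hA']
    linarith

end Setting

end TwoGroup

theorem theorem5p1 (s : TwoGroup.Setting) (Θ : Set TwoGroup.Param) (hΘ : s.IsParamSpace Θ)
    (hmax : ∀ θ ∈ Θ, IsGreatest (TwoGroup.nullProportions Θ θ) (TwoGroup.piStar Θ θ))
    (piHat : s.Estimator) (ηs δs : s.Index → TwoGroup.Param → ℝ)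
    (hHat : s.ConcentratesBelow Θ piHat ηs δs) :
    -- (i) optimality without capping
    ((∀ (piTilde : s.Estimator) (piBar : TwoGroup.Param → ℝ) (η δ : s.Index → TwoGroup.Param → ℝ),
        s.FDRConservative Θ piTilde 1 →
        s.Concentrating Θ piTilde piBar η δ →
        ∀ θ ∈ Θ, ∀ᶠ t in atTop, ∀ α ∈ Ioc (0 : ℝ) 1,
          s.power t θ (piTilde.est t)
              (α * (1 - ηs t θ / TwoGroup.piStar Θ θ) *
                (1 - η t θ / (TwoGroup.piStar Θ θ - η t θ))) 1
            - s.power t θ (piHat.est t) α 1 ≤ δs t θ + δ t θ) ∧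
      -- the oracle choice
      (∀ θ ∈ Θ, ∀ᶠ t in atTop, ∀ α ∈ Ioc (0 : ℝ) 1,
          s.power t θ (fun _ => TwoGroup.piStar Θ θ)
              (α * (1 - ηs t θ / TwoGroup.piStar Θ θ)) 1
            - s.power t θ (piHat.est t) α 1 ≤ δs t θ)) ∧
    -- (ii) optimality with capping
    (∀ κ ∈ Ioo (0 : ℝ) 1,
      (∀ (piTilde : s.Estimator) (piBar : TwoGroup.Param → ℝ)
          (η δ : s.Index → TwoGroup.Param → ℝ) (κ' : ℝ), κ' ∈ Ioc (0 : ℝ) 1 →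
        (κ' = 1 ∨ ∀ θ ∈ Θ, θ.HasUniformNull) →
        s.FDRConservative Θ piTilde κ' →
        s.Concentrating Θ piTilde piBar η δ →
        ∀ θ ∈ Θ, ∀ᶠ t in atTop, ∀ α ∈ Ioc (0 : ℝ) (κ * TwoGroup.piStar Θ θ),
          s.power t θ (piTilde.est t)
              (α * (1 - ηs t θ / TwoGroup.piStar Θ θ) *
                (1 - η t θ / (TwoGroup.piStar Θ θ - η t θ))) 1
            - s.power t θ (piHat.est t) α κ ≤ δs t θ + δ t θ) ∧
      -- the oracle choice
      (∀ θ ∈ Θ, ∀ᶠ t in atTop, ∀ α ∈ Ioc (0 : ℝ) (κ * TwoGroup.piStar Θ θ),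
          s.power t θ (fun _ => TwoGroup.piStar Θ θ)
              (α * (1 - ηs t θ / TwoGroup.piStar Θ θ)) 1
            - s.power t θ (piHat.est t) α κ ≤ δs t θ)) := by
  refine ⟨⟨?_, ?_⟩, fun κ hκ => ⟨?_, ?_⟩⟩
  · intro piTilde piBar η δ hfdr hconc θ hθ
    have hbar := TwoGroup.Setting.piStar_le_piBar s hmax ⟨zero_lt_one, le_rfl⟩ (Or.inl rfl) hfdr
      hconc hθ
    filter_upwards [TwoGroup.Setting.eventually_power_sub_le hmax hHat hconc hθ hbar] with t h α hα
    exact h α 1 hα.1.le zero_le_one (Or.inl le_rfl)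
  · intro θ hθ
    filter_upwards [TwoGroup.Setting.eventually_oracle_power_sub_le hmax hHat hθ] with t h α hα
    exact h α 1 hα.1.le zero_le_one (Or.inl le_rfl)
  · intro piTilde piBar η δ κ' hκ' hnull hfdr hconc θ hθ
    have hbar := TwoGroup.Setting.piStar_le_piBar s hmax hκ' hnull hfdr hconc hθ
    filter_upwards [TwoGroup.Setting.eventually_power_sub_le hmax hHat hconc hθ hbar] with t h α hα
    exact h α κ hα.1.le hκ.1.le (Or.inr hα.2)
  · intro θ hθ
    filter_upwards [TwoGroup.Setting.eventually_oracle_power_sub_le hmax hHat hθ] with t h α hα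
    exact h α κ hα.1.le hκ.1.le (Or.inr hα.2)
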